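/- All subgroups are taken to be closed. Let $G$ be a just infinite profinite group; that is, $G$ is an infinite profinite group in which every non-trivial closed normal subgroup has finite index. Then the following are equivalent: (i) $G$ is virtually pronilpotent, i.e. $G$ has a closed subgroup of finite index that is an inverse limit of finite nilpotent groups; (ii) $G$ is virtually pro-$p$ for some prime $p$, i.e. for some prime $p$ the group $G$ has a closed subgroup of finite index that is an inverse limit of finite $p$-groups; (iii) $G$ has only finitely many maximal open subgroups (proper open subgroups not contained in any larger proper open subgroup). -/

import Mathlib

open CategoryTheory

universe u

/-- A topological group `G` is just infinite if it is infinite, residually finite (its closed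
normal subgroups of finite index intersect trivially), and every nontrivial closed normal
subgroup has finite index. -/
def IsJustInfinite (G : Type u) [Group G] [TopologicalSpace G] : Prop :=
  Infinite G ∧
  (∀ g : G, (∀ N : Subgroup G, N.Normal → IsClosed (N : Set G) → N.FiniteIndex → g ∈ N) → g = 1) ∧
  ∀ N : Subgroup G, N.Normal → IsClosed (N : Set G) → N ≠ ⊥ → N.FiniteIndex

/-- `G` is, as a topological group, the limit of an inverse system of finite (discrete) groups
satisfying `C`, indexed by a nonempty directed preorder. Here the indices are ordered so that the
transition maps go from smaller to larger indices, hence the system is directed downwards. -/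
def IsInverseLimitOfFinite (C : FiniteGrp.{u} → Prop)
    (G : Type u) [Group G] [TopologicalSpace G] : Prop :=
  ∃ (J : Type u) (_ : Preorder J) (_ : Nonempty J) (_ : IsCodirectedOrder J)
    (F : J ⥤ FiniteGrp.{u}), (∀ j, C (F.obj j)) ∧
      Nonempty (G ≃ₜ* ProfiniteGrp.limit (F ⋙ forget₂ FiniteGrp.{u} ProfiniteGrp.{u}))

/-- An inverse limit of finite nilpotent groups. -/
def IsPronilpotent (G : Type u) [Group G] [TopologicalSpace G] : Prop :=
  IsInverseLimitOfFinite (fun Q : FiniteGrp.{u} => Group.IsNilpotent Q) G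

/-- An inverse limit of finite `p`-groups. -/
def IsProP (p : ℕ) (G : Type u) [Group G] [TopologicalSpace G] : Prop :=
  IsInverseLimitOfFinite (fun Q : FiniteGrp.{u} => IsPGroup p Q) G

/-- Some closed subgroup of finite index is pronilpotent. -/
def IsVirtuallyPronilpotent (G : Type u) [Group G] [TopologicalSpace G] : Prop :=
  ∃ H : Subgroup G, IsClosed (H : Set G) ∧ H.FiniteIndex ∧ IsPronilpotent H

/-- Some closed subgroup of finite index is pro-`p`. -/
def IsVirtuallyProP (p : ℕ) (G : Type u) [Group G] [TopologicalSpace G] : Prop :=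
  ∃ H : Subgroup G, IsClosed (H : Set G) ∧ H.FiniteIndex ∧ IsProP p H

/-!
Throughout, `G` is a just infinite profinite group, and the three conditions are proved equivalent
in a cycle.

*Virtually pronilpotent implies virtually pro-`p`.* Let `N` be the normal core of a pronilpotent
subgroup of finite index. For a prime `p`, the elements of `N` that have `p`-power order modulo every
open normal subgroup form a closed normal subgroup of `G`, the Sylow pro-`p` subgroup of `N`: closure
under products holds in finite nilpotent groups, because their Sylow subgroups are normal
(`exists_subgroup_mem_iff_pow_prime_pow_mem`). A compactness argument shows that it is nontrivial
for some `p` (`exists_prime_exists_ne_one_pow_prime_pow_mem`), hence of finite index.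

*Virtually pro-`p` implies finitely many maximal open subgroups.* Let `N` be the normal core of a
pro-`p` subgroup of finite index, and `D` the intersection of its maximal open subgroups, which is
closed and normal in `G`. Maximal open subgroups of `N` contain all `p`-th powers and commutators, so
if `D` were trivial, `N` would be elementary abelian; an element of `N` would then have finitely
many conjugates in `G`, and its normal closure would be a finite normal subgroup of the infinite group
`G`, contradicting just infiniteness (`openFrattini_ne_bot_of_isJustInfinite`). So `D` has finite
index. By the modular law, every maximal open subgroup of `G` contains `D`
(`openFrattini_le_of_isCoatom`), and only finitely many subgroups do.

*Finitely many maximal open subgroups implies virtually pronilpotent.* Their intersection is open, and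
its image in a finite quotient of `G` lies in the Frattini subgroup of that quotient, which is
nilpotent by the Frattini argument. This step holds for every profinite group.
-/

/-! ### Inverse limits of finite groups and their open subgroups -/

/-- In an inverse limit of finite groups satisfying `C`, every neighbourhood of `1` contains the
open kernel of a homomorphism to one of these groups. -/
theorem IsInverseLimitOfFinite.exists_hom_ker_subset {C : FiniteGrp.{u} → Prop} {H : Type u}
    [Group H] [TopologicalSpace H] [CompactSpace H] (h : IsInverseLimitOfFinite C H)
    {W : Set H} (hW : IsOpen W) (h1 : (1 : H) ∈ W) :
    ∃ Q : FiniteGrp.{u}, C Q ∧ ∃ f : H →* Q, IsOpen (f.ker : Set H) ∧ (f.ker : Set H) ⊆ W := by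
  obtain ⟨J, _, _, _, F, hC, ⟨e⟩⟩ := h
  let π (j : J) : H →* F.obj j :=
    { toFun := fun x => (e x).1 j
      map_one' := by rw [map_one]; rfl
      map_mul' := fun x y => by rw [map_mul]; rfl }
  have hker (j : J) : IsClopen ((π j).ker : Set H) := by
    let _ : TopologicalSpace (F.obj j) := ⊥
    have : DiscreteTopology (F.obj j) := ⟨rfl⟩
    have hc : Continuous (π j) :=
      (continuous_apply j).comp (continuous_subtype_val.comp e.continuous)
    exact (isClopen_discrete ({1} : Set (F.obj j))).preimage hc
  have hmono {i j : J} (hij : i ≤ j) : (π i).ker ≤ (π j).ker := by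
    intro x hx
    have h2 := (e x).2 (homOfLE hij)
    rw [MonoidHom.mem_ker] at hx ⊢
    change (e x).1 i = 1 at hx
    change (e x).1 j = 1
    rw [← h2, hx, map_one]
  obtain ⟨j, hj⟩ := hW.isClosed_compl.isCompact.elim_directed_family_closed
    (fun j => ((π j).ker : Set H)) (fun j => (hker j).isClosed)
    (by
      rw [Set.eq_empty_iff_forall_notMem]
      rintro x ⟨hxW, hx⟩
      refine hxW ?_
      have : x = 1 := by
        apply e.injective
        rw [map_one]
        apply ProfiniteGrp.limit_ext
        intro j
        exact Set.mem_iInter.1 hx j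
      rwa [this])
    (fun i j => by
      obtain ⟨k, hki, hkj⟩ := exists_le_le i j
      exact ⟨k, hmono hki, hmono hkj⟩)
  refine ⟨F.obj j, hC j, π j, (hker j).isOpen, fun x hx => ?_⟩
  by_contra hxW
  exact Set.eq_empty_iff_forall_notMem.1 hj x ⟨hxW, hx⟩

/-- A profinite group is the inverse limit of its quotients by open normal subgroups. -/
theorem isInverseLimitOfFinite_of_quotients {C : FiniteGrp.{u} → Prop} {H : Type u}
    [Group H] [TopologicalSpace H] [IsTopologicalGroup H] [CompactSpace H]
    [TotallyDisconnectedSpace H]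
    (h : ∀ U : OpenNormalSubgroup H, C (FiniteGrp.of (H ⧸ U.toSubgroup))) :
    IsInverseLimitOfFinite C H :=
  ⟨OpenNormalSubgroup H, inferInstance, ⟨⟨⊤, Subgroup.normal_top⟩⟩, inferInstance,
    (ProfiniteGrp.of H).toFiniteQuotientFunctor, fun U => h U,
    ⟨(ProfiniteGrp.of H).continuousMulEquivLimittoFiniteQuotientFunctor⟩⟩

/-- An open subgroup of an open subgroup contains an open normal subgroup of the whole group. -/
theorem exists_openNormalSubgroup_subgroupOf_le {G : Type*} [Group G] [TopologicalSpace G]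
    [IsTopologicalGroup G] [CompactSpace G] [TotallyDisconnectedSpace G] {H : Subgroup G}
    (hH : IsOpen (H : Set G)) {V : Subgroup H} (hV : IsOpen (V : Set H)) :
    ∃ U : OpenNormalSubgroup G, U.toSubgroup.subgroupOf H ≤ V := by
  obtain ⟨U, hU⟩ := ProfiniteGrp.exist_openNormalSubgroup_sub_open_nhds_of_one
    (hH.isOpenMap_subtype_val _ hV) ⟨1, V.one_mem, rfl⟩
  refine ⟨U, fun x hx => ?_⟩
  obtain ⟨y, hy, hyx⟩ := hU hx
  rwa [← Subtype.ext hyx]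

/-! ### Elements of prime power order -/

/-- In a finite nilpotent group the elements of `p`-power order are closed under products, because
they all lie in the unique Sylow `p`-subgroup. -/
theorem Group.IsNilpotent.exists_mul_pow_prime_pow_eq_one {Q : Type*} [Group Q] [Finite Q]
    [Group.IsNilpotent Q] {p : ℕ} [Fact p.Prime] {x y : Q} (hx : ∃ k : ℕ, x ^ p ^ k = 1)
    (hy : ∃ k : ℕ, y ^ p ^ k = 1) : ∃ k : ℕ, (x * y) ^ p ^ k = 1 := by
  have key (z : Q) (hz : ∃ k : ℕ, z ^ p ^ k = 1) : IsPGroup p (Subgroup.zpowers z) := by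
    obtain ⟨k, hk⟩ := hz
    rintro ⟨w, n, rfl⟩
    refine ⟨k, Subtype.ext ?_⟩
    simp only [Subgroup.coe_pow, Subgroup.coe_one]
    rw [← zpow_natCast, ← zpow_mul, mul_comm, zpow_mul, zpow_natCast, hk, one_zpow]
  obtain ⟨P, hP⟩ := (key x hx).exists_le_sylow
  obtain ⟨P', hP'⟩ := (key y hy).exists_le_sylow
  have : Unique (Sylow p Q) := Sylow.unique_of_normal P inferInstance
  obtain rfl : P = P' := Subsingleton.elim _ _
  obtain ⟨k, hk⟩ := P.isPGroup' ⟨x * y, P.mul_mem (hP (Subgroup.mem_zpowers x))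
    (hP' (Subgroup.mem_zpowers y))⟩
  exact ⟨k, congrArg Subtype.val hk⟩

/-- A maximal subgroup containing the kernel of a homomorphism to a finite `p`-group is normal with
quotient of order `p`; hence it contains all `p`-th powers and all commutators. -/
theorem IsPGroup.pow_mem_and_commutator_mem_of_isCoatom {N Q : Type*} [Group N] [Group Q]
    [Finite Q] {p : ℕ} [Fact p.Prime] (hQ : IsPGroup p Q) (f : N →* Q) {M : Subgroup N}
    (hM : IsCoatom M) (hf : f.ker ≤ M) :
    (∀ x, x ^ p ∈ M) ∧ ∀ x y, x * y * x⁻¹ * y⁻¹ ∈ M := by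
  have hR : IsPGroup p f.range := hQ.to_subgroup _
  have : Group.IsNilpotent f.range := hR.isNilpotent
  set g := f.rangeRestrict with hg
  have hgs : Function.Surjective g := f.rangeRestrict_surjective
  have hgk : g.ker ≤ M := by rwa [hg, MonoidHom.ker_rangeRestrict]
  have hcomap : (M.map g).comap g = M := Subgroup.comap_map_eq_self hgk
  have hco : IsCoatom (M.map g) := by
    refine ⟨fun h => hM.1 (by rw [← hcomap, h, Subgroup.comap_top]), fun B hB => ?_⟩
    have h2 : M < B.comap g := by
      rw [← hcomap]; exact (Subgroup.comap_lt_comap_of_surjective hgs).2 hB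
    have := hM.2 _ h2
    rw [← Subgroup.map_comap_eq_self_of_surjective hgs B, this,
      Subgroup.map_top_of_surjective _ hgs]
  have hnorm : (M.map g).Normal :=
    Subgroup.NormalizerCondition.normal_of_coatom _ Group.normalizerCondition_of_isNilpotent hco
  have hMn : M.Normal := by rw [← hcomap]; infer_instance
  have hfin : Finite (N ⧸ M) := by
    have : g.ker.FiniteIndex := inferInstance
    have : M.FiniteIndex := Subgroup.finiteIndex_of_le hgk
    infer_instance
  have hp : IsPGroup p (N ⧸ M) := by
    intro x
    obtain ⟨x, rfl⟩ := QuotientGroup.mk_surjective x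
    obtain ⟨k, hk⟩ := hQ (f x)
    refine ⟨k, ?_⟩
    rw [← QuotientGroup.mk_pow, QuotientGroup.eq_one_iff]
    exact hf (by rw [MonoidHom.mem_ker, map_pow, hk])
  have hsub (B : Subgroup (N ⧸ M)) : B = ⊥ ∨ B = ⊤ := by
    have hs := QuotientGroup.mk'_surjective M
    have hle : M ≤ B.comap (QuotientGroup.mk' M) := by
      intro x hx
      rw [Subgroup.mem_comap, QuotientGroup.mk'_apply, (QuotientGroup.eq_one_iff x).2 hx]
      exact B.one_mem
    rw [← Subgroup.map_comap_eq_self_of_surjective hs B]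
    rcases hle.eq_or_lt with h | h
    · left
      rw [← h, QuotientGroup.map_mk'_self]
    · right
      rw [hM.2 _ h, Subgroup.map_top_of_surjective _ hs]
  have hnt : Nontrivial (N ⧸ M) := QuotientGroup.nontrivial_iff.2 hM.1
  have hcenter : Subgroup.center (N ⧸ M) = ⊤ :=
    (hsub _).resolve_left ((Subgroup.nontrivial_iff_ne_bot _).1 hp.center_nontrivial)
  have hcomm (a b : N ⧸ M) : a * b = b * a :=
    (Subgroup.mem_center_iff.1 (hcenter ▸ Subgroup.mem_top b) a)
  constructor
  · let _ : CommGroup (N ⧸ M) := { (inferInstance : Group (N ⧸ M)) with mul_comm := hcomm }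
    have : IsSimpleGroup (N ⧸ M) := ⟨fun B _ => hsub B⟩
    have hprime : (Nat.card (N ⧸ M)).Prime := IsSimpleGroup.prime_card
    obtain ⟨n, hn⟩ := IsPGroup.iff_card.1 hp
    have hcard : Nat.card (N ⧸ M) = p := by
      rw [hn] at hprime ⊢
      rw [hprime.eq_one_of_pow, pow_one]
    intro x
    rw [← QuotientGroup.eq_one_iff, QuotientGroup.mk_pow, ← hcard]
    exact pow_card_eq_one'
  · intro x y
    rw [← QuotientGroup.eq_one_iff]
    simp only [QuotientGroup.mk_mul, QuotientGroup.mk_inv]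
    rw [hcomm (x : N ⧸ M) y]
    group

/-! ### Pronilpotent just infinite groups are virtually pro-`p` -/

/-- Being of `p`-power order modulo an open normal subgroup is a closed condition. -/
theorem isClosed_setOf_exists_pow_prime_pow_mem {G : Type*} [Group G] [TopologicalSpace G]
    [IsTopologicalGroup G] (p : ℕ) (U : OpenNormalSubgroup G) :
    IsClosed {x : G | ∃ k : ℕ, x ^ p ^ k ∈ U.toSubgroup} := by
  have : DiscreteTopology (G ⧸ U.toSubgroup) :=
    inferInstanceAs (DiscreteTopology (G ⧸ U.toOpenSubgroup.toSubgroup))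
  have h := (isClosed_discrete {q : G ⧸ U.toSubgroup | ∃ k : ℕ, q ^ p ^ k = 1}).preimage
    (QuotientGroup.continuous_mk (N := U.toSubgroup))
  convert h using 1
  ext x
  simp only [Set.mem_ofPred_eq, Set.mem_preimage, ← QuotientGroup.mk_pow, QuotientGroup.eq_one_iff]

section

variable {G : Type u} [Group G] [TopologicalSpace G] [IsTopologicalGroup G] [CompactSpace G]
  [TotallyDisconnectedSpace G]

/-- A nontrivial closed subgroup contains, for some prime `p`, a nontrivial element which has
`p`-power order modulo every open normal subgroup. -/
theorem exists_prime_exists_ne_one_pow_prime_pow_mem {N : Subgroup G} (hN : IsClosed (N : Set G))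
    (hne : N ≠ ⊥) :
    ∃ p : ℕ, p.Prime ∧ ∃ y ∈ N, y ≠ 1 ∧
      ∀ U : OpenNormalSubgroup G, ∃ k : ℕ, y ^ p ^ k ∈ U.toSubgroup := by
  obtain ⟨x, hxN, hx1⟩ := N.bot_or_exists_ne_one.resolve_left hne
  obtain ⟨U₀, hU₀⟩ := ProfiniteGrp.exist_openNormalSubgroup_sub_open_nhds_of_one
    (isOpen_compl_singleton (x := x)) (fun h => hx1 h.symm)
  have hxU₀ : x ∉ U₀.toSubgroup := fun h => hU₀ h rfl
  -- `p` divides the order of `x` modulo `U₀`, so the `p`-part of `x` is nontrivial modulo `U₀`.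
  set p := (orderOf (x : G ⧸ U₀.toSubgroup)).minFac with hp_def
  have hp : p.Prime := Nat.minFac_prime fun h =>
    hxU₀ ((QuotientGroup.eq_one_iff x).1 (orderOf_eq_one_iff.1 h))
  let S (U : OpenNormalSubgroup G) : Set G :=
    ((N : Set G) ∩ (U₀ : Set G)ᶜ) ∩ {y | ∃ k : ℕ, y ^ p ^ k ∈ U.toSubgroup}
  have hSc (U : OpenNormalSubgroup G) : IsClosed (S U) :=
    (hN.inter U₀.toOpenSubgroup.isOpen.isClosed_compl).inter
      (isClosed_setOf_exists_pow_prime_pow_mem p U)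
  have hSn (U : OpenNormalSubgroup G) : (S U).Nonempty := by
    have : Finite (G ⧸ U.toSubgroup) := U.toSubgroup.quotient_finite_of_isOpen U.isOpen'
    have hn : orderOf (x : G ⧸ U.toSubgroup) ≠ 0 := (orderOf_pos _).ne'
    obtain ⟨a, m, hm, hnm⟩ := Nat.exists_eq_pow_mul_and_not_dvd hn p hp.ne_one
    refine ⟨x ^ m, ⟨N.pow_mem hxN m, fun h => hm ?_⟩, a, ?_⟩
    · have h1 : (x : G ⧸ U₀.toSubgroup) ^ m = 1 := by
        rw [← QuotientGroup.mk_pow]; exact (QuotientGroup.eq_one_iff _).2 h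
      exact (Nat.minFac_dvd _).trans (orderOf_dvd_of_pow_eq_one h1)
    · rw [← QuotientGroup.eq_one_iff, ← pow_mul, mul_comm, ← hnm, QuotientGroup.mk_pow,
        pow_orderOf_eq_one]
  have : Nonempty (OpenNormalSubgroup G) := ⟨U₀⟩
  obtain ⟨y, hy⟩ := IsCompact.nonempty_iInter_of_directed_nonempty_isCompact_isClosed S
    (fun U V => ⟨U ⊓ V, fun y hy => ⟨hy.1, hy.2.imp fun k hk => hk.1⟩,
      fun y hy => ⟨hy.1, hy.2.imp fun k hk => hk.2⟩⟩) hSn (fun U => (hSc U).isCompact) hSc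
  rw [Set.mem_iInter] at hy
  refine ⟨p, hp, y, (hy U₀).1.1, ?_, fun U => (hy U).2⟩
  rintro rfl
  exact (hy U₀).1.2 U₀.one_mem

/-- The elements of a closed normal subgroup `N` that have `p`-power order modulo every open normal
subgroup form a closed normal subgroup, provided `N` lies in an open pronilpotent subgroup. This is
the Sylow pro-`p` subgroup of `N`. -/
theorem exists_subgroup_mem_iff_pow_prime_pow_mem {H N : Subgroup G} (hH : IsOpen (H : Set G))
    (hpro : IsPronilpotent H) (hNH : N ≤ H) [N.Normal] (hN : IsClosed (N : Set G)) {p : ℕ}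
    (hp : p.Prime) :
    ∃ P : Subgroup G, P.Normal ∧ IsClosed (P : Set G) ∧
      ∀ x, x ∈ P ↔ x ∈ N ∧ ∀ U : OpenNormalSubgroup G, ∃ k : ℕ, x ^ p ^ k ∈ U.toSubgroup := by
  have : CompactSpace H := isCompact_iff_compactSpace.1 (Subgroup.isClosed_of_isOpen H hH).isCompact
  have : Fact p.Prime := ⟨hp⟩
  let P : Subgroup G :=
    { carrier := {x | x ∈ N ∧ ∀ U : OpenNormalSubgroup G, ∃ k : ℕ, x ^ p ^ k ∈ U.toSubgroup}
      one_mem' := ⟨N.one_mem, fun U => ⟨0, by rw [one_pow]; exact U.one_mem⟩⟩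
      inv_mem' := fun {x} hx => ⟨N.inv_mem hx.1, fun U => (hx.2 U).imp fun k hk => by
        rw [inv_pow]; exact U.toSubgroup.inv_mem hk⟩
      mul_mem' := by
        rintro x y ⟨hxN, hx⟩ ⟨hyN, hy⟩
        refine ⟨N.mul_mem hxN hyN, fun U => ?_⟩
        obtain ⟨Q, hQ, f, hf, hfU⟩ := hpro.exists_hom_ker_subset
          (W := (U.toSubgroup.subgroupOf H : Set H))
          (U.isOpen'.preimage continuous_subtype_val) (one_mem _)
        have : Group.IsNilpotent Q := hQ
        obtain ⟨V, hV⟩ := exists_openNormalSubgroup_subgroupOf_le hH hf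
        have key (z : G) (hzN : z ∈ N) (hz : ∃ k : ℕ, z ^ p ^ k ∈ V.toSubgroup) :
            ∃ k : ℕ, f ⟨z, hNH hzN⟩ ^ p ^ k = 1 :=
          hz.imp fun k hk => by
            rw [← map_pow]
            exact hV (x := (⟨z, hNH hzN⟩ : H) ^ p ^ k) hk
        obtain ⟨k, hk⟩ := Group.IsNilpotent.exists_mul_pow_prime_pow_eq_one
          (key x hxN (hx V)) (key y hyN (hy V))
        rw [← map_mul, ← map_pow] at hk
        exact ⟨k, hfU hk⟩ }
  refine ⟨P, ⟨?_⟩, ?_, fun x => Iff.rfl⟩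
  · rintro x ⟨hxN, hx⟩ g
    refine ⟨Subgroup.Normal.conj_mem inferInstance x hxN g, fun U => (hx U).imp fun k hk => ?_⟩
    rw [conj_pow]
    exact U.isNormal'.conj_mem _ hk g
  · have : (P : Set G) = (N : Set G) ∩ ⋂ U : OpenNormalSubgroup G,
        {x | ∃ k : ℕ, x ^ p ^ k ∈ U.toSubgroup} := by
      ext x; simp [P, Set.mem_iInter]
    rw [this]
    exact hN.inter (isClosed_iInter fun U => isClosed_setOf_exists_pow_prime_pow_mem p U)

/-- A virtually pronilpotent just infinite profinite group is virtually pro-`p`: a nontrivial Sylow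
pro-`p` subgroup of a pronilpotent open normal subgroup is normal in `G`, hence open. -/
theorem IsVirtuallyPronilpotent.exists_isVirtuallyProP (hG : IsJustInfinite G)
    (h : IsVirtuallyPronilpotent G) : ∃ p : ℕ, p.Prime ∧ IsVirtuallyProP p G := by
  obtain ⟨hinf, -, hji⟩ := hG
  obtain ⟨H, hHc, hHf, hpro⟩ := h
  have hHo : IsOpen (H : Set G) := H.isOpen_of_isClosed_of_finiteIndex hHc
  have hNc : IsClosed (H.normalCore : Set G) := H.normalCore_isClosed hHc
  have hne : H.normalCore ≠ ⊥ := fun hbot =>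
    Subgroup.FiniteIndex.index_ne_zero (H := H.normalCore)
      (by rw [hbot, Subgroup.index_bot, Nat.card_eq_zero_of_infinite])
  obtain ⟨p, hp, y, hyN, hy1, hy⟩ := exists_prime_exists_ne_one_pow_prime_pow_mem hNc hne
  obtain ⟨P, hPn, hPc, hP⟩ :=
    exists_subgroup_mem_iff_pow_prime_pow_mem hHo hpro H.normalCore_le hNc hp
  have hPf : P.FiniteIndex := hji P hPn hPc fun hbot =>
    hy1 (Subgroup.mem_bot.1 (hbot ▸ (hP y).2 ⟨hyN, hy⟩))
  refine ⟨p, hp, P, hPc, hPf, ?_⟩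
  have : CompactSpace P := isCompact_iff_compactSpace.1 hPc.isCompact
  refine isInverseLimitOfFinite_of_quotients fun V => ?_
  obtain ⟨U, hU⟩ := exists_openNormalSubgroup_subgroupOf_le
    (P.isOpen_of_isClosed_of_finiteIndex hPc) V.isOpen'
  intro x
  obtain ⟨x, rfl⟩ := QuotientGroup.mk_surjective x
  obtain ⟨k, hk⟩ := ((hP x).1 x.2).2 U
  exact ⟨k, (QuotientGroup.eq_one_iff (x ^ p ^ k)).2 (hU hk)⟩

end

/-! ### Maximal open subgroups -/

/-- A subgroup of finite index has only finitely many overgroups. -/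
theorem Subgroup.finite_setOf_le_of_finiteIndex {G : Type*} [Group G] (V : Subgroup G)
    [V.FiniteIndex] : {K : Subgroup G | V ≤ K}.Finite := by
  have h : {K : Subgroup G | V.normalCore ≤ K}.Finite :=
    Set.finite_coe_iff.1 (Finite.of_equiv _ (QuotientGroup.comapMk'OrderIso V.normalCore).toEquiv)
  exact h.subset fun K hK => V.normalCore_le.trans hK

/-- A subgroup of finite index properly contained in `N` lies in a maximal subgroup of `N`. -/
theorem Subgroup.exists_le_covBy_of_finiteIndex {G : Type*} [Group G] {L N : Subgroup G}
    [L.FiniteIndex] (h : L < N) : ∃ M, L ≤ M ∧ M ⋖ N := by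
  have hfin : {K : Subgroup G | L ≤ K ∧ K < N}.Finite :=
    L.finite_setOf_le_of_finiteIndex.subset fun K hK => hK.1
  obtain ⟨M, hM⟩ := hfin.exists_maximal ⟨L, le_rfl, h⟩
  refine ⟨M, hM.prop.1, hM.prop.2, fun K hMK hKN => ?_⟩
  exact hMK.not_ge (hM.le_of_ge ⟨hM.prop.1.trans hMK.le, hKN⟩ hMK.le)

/-- A maximal open subgroup is maximal among all subgroups. -/
theorem OpenSubgroup.isCoatom_toSubgroup {G : Type*} [Group G] [TopologicalSpace G]
    [IsTopologicalGroup G] {M : OpenSubgroup G} (hM : IsCoatom M) : IsCoatom M.toSubgroup := by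
  refine ⟨fun h => hM.1 (OpenSubgroup.toSubgroup_injective h), fun B hB => ?_⟩
  have := hM.2 ⟨B, Subgroup.isOpen_mono hB.le M.isOpen⟩ hB
  exact congrArg OpenSubgroup.toSubgroup this

open scoped IsMulCommutative in
/-- In an abelian normal subgroup of finite index and finite exponent, every element has only
finitely many conjugates, so that its normal closure is finite. -/
theorem Subgroup.finite_normalClosure_singleton {G : Type*} [Group G] {N : Subgroup G}
    [N.Normal] [N.FiniteIndex] (hcomm : ∀ x ∈ N, ∀ y ∈ N, x * y = y * x) {x : G} (hx : x ∈ N)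
    {n : ℕ} (hn : n ≠ 0) (hpow : ∀ x ∈ N, x ^ n = 1) :
    Finite (Subgroup.normalClosure {x}) := by
  have hsub : Group.conjugatesOfSet {x} ⊆ (N : Set G) :=
    Group.conjugatesOfSet_subset (Set.singleton_subset_iff.2 hx)
  -- `g * x * g⁻¹` depends only on the coset of `g` modulo `N`.
  have hfin : (Group.conjugatesOfSet {x}).Finite := by
    refine (Set.finite_range fun q : G ⧸ N => q.out * x * q.out⁻¹).subset ?_
    intro y hy
    obtain ⟨z, hz, hzy⟩ := Group.mem_conjugatesOfSet_iff.1 hy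
    rw [Set.mem_singleton_iff.1 hz] at hzy
    obtain ⟨g, rfl⟩ := isConj_iff.1 hzy
    obtain ⟨m, hm⟩ := QuotientGroup.mk_out_eq_mul N g
    refine ⟨(g : G ⧸ N), ?_⟩
    simp only [hm]
    have := hcomm m m.2 x hx
    rw [mul_inv_rev, mul_assoc g, this]
    group
  have : IsMulCommutative (Subgroup.normalClosure {x}) :=
    Subgroup.isMulCommutative_closure fun a ha b hb => hcomm a (hsub ha) b (hsub hb)
  have : Group.FG (Subgroup.normalClosure {x}) :=
    (Group.fg_iff_subgroup_fg _).2 ⟨hfin.toFinset, by rw [hfin.coe_toFinset]; rfl⟩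
  refine CommGroup.finite_of_fg_isMulTorsion _ fun y => ?_
  have hy : (y : G) ∈ N := Subgroup.normalClosure_le_normal (Set.singleton_subset_iff.2 hx) y.2
  exact isOfFinOrder_iff_pow_eq_one.2 ⟨n, Nat.pos_of_ne_zero hn, Subtype.ext (hpow y hy)⟩

/-- The intersection of the maximal open subgroups of `N`, as a subgroup of the ambient group;
it is `N` itself if there are none. Open means open in the ambient group, which is the same as open
in `N` when `N` is open. -/
def openFrattini {G : Type*} [Group G] [TopologicalSpace G] (N : Subgroup G) : Subgroup G :=
  N ⊓ sInf {M : Subgroup G | IsOpen (M : Set G) ∧ M ⋖ N}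

theorem mem_openFrattini {G : Type*} [Group G] [TopologicalSpace G] {N : Subgroup G} {x : G} :
    x ∈ openFrattini N ↔ x ∈ N ∧ ∀ M : Subgroup G, IsOpen (M : Set G) → M ⋖ N → x ∈ M := by
  simp [openFrattini, Subgroup.mem_inf, Subgroup.mem_sInf]

section

variable {G : Type*} [Group G] [TopologicalSpace G] [IsTopologicalGroup G]

theorem isClosed_openFrattini {N : Subgroup G} (hN : IsClosed (N : Set G)) :
    IsClosed (openFrattini N : Set G) := by
  rw [openFrattini, Subgroup.coe_inf, Subgroup.coe_sInf]
  exact hN.inter (isClosed_biInter fun M hM => M.isClosed_of_isOpen hM.1)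

instance openFrattini_normal (N : Subgroup G) [hN : N.Normal] : (openFrattini N).Normal := by
  refine ⟨fun x hx g => ?_⟩
  rw [mem_openFrattini] at hx ⊢
  refine ⟨hN.conj_mem x hx.1 g, fun M hMo hM => ?_⟩
  -- Conjugation by `g` permutes the maximal open subgroups of `N`.
  let φ : G ≃* G := MulAut.conj g
  have hMφ : M.comap φ.toMonoidHom ⋖ N := by
    have hNφ : N.comap φ.toMonoidHom = N := by
      ext y
      exact ⟨fun hy => by simpa [φ, mul_assoc] using hN.conj_mem _ hy g⁻¹,
        fun hy => hN.conj_mem y hy g⟩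
    rw [← hNφ]
    exact (apply_covBy_apply_iff φ.comapSubgroup).2 hM
  have ho : IsOpen (M.comap φ.toMonoidHom : Set G) :=
    hMo.preimage (IsTopologicalGroup.continuous_conj g)
  exact hx.2 _ ho hMφ

/-- The maximal open subgroups of a normal subgroup `N` of finite index inside an open pro-`p`
subgroup do not intersect trivially: otherwise `N` would be elementary abelian, and a nontrivial
element of `N` would have a finite normal closure in `G`. -/
theorem openFrattini_ne_bot_of_isJustInfinite {G : Type u} [Group G] [TopologicalSpace G]
    [IsTopologicalGroup G] [CompactSpace G] [TotallyDisconnectedSpace G] (hG : IsJustInfinite G)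
    {p : ℕ} (hp : p.Prime) {H N : Subgroup G} (hH : IsOpen (H : Set G)) (hpro : IsProP p H)
    (hNH : N ≤ H) [N.Normal] [N.FiniteIndex] : openFrattini N ≠ ⊥ := by
  intro hbot
  obtain ⟨hinf, -, hji⟩ := hG
  have : CompactSpace H := isCompact_iff_compactSpace.1 (Subgroup.isClosed_of_isOpen H hH).isCompact
  have : Fact p.Prime := ⟨hp⟩
  have key (M : Subgroup G) (hMo : IsOpen (M : Set G)) (hM : M ⋖ N) :
      (∀ x ∈ N, x ^ p ∈ M) ∧ ∀ x ∈ N, ∀ y ∈ N, x * y * x⁻¹ * y⁻¹ ∈ M := by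
    obtain ⟨Q, hQ, f, -, hf⟩ := hpro.exists_hom_ker_subset
      (W := (M.subgroupOf H : Set H)) (hMo.preimage continuous_subtype_val) (one_mem _)
    have hco : IsCoatom (M.subgroupOf N) := by
      refine ⟨fun h => hM.lt.not_ge (Subgroup.subgroupOf_eq_top.1 h), fun B hB => ?_⟩
      have h1 : M < B.map N.subtype := by
        have := (Subgroup.map_lt_map_iff_of_injective N.subtype_injective).2 hB
        rwa [Subgroup.subgroupOf_map_subtype, inf_eq_left.2 hM.le] at this
      have h2 : B.map N.subtype = N := (Subgroup.map_subtype_le B).eq_of_not_lt (hM.2 h1)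
      rw [← Subgroup.comap_map_eq_self_of_injective N.subtype_injective B, h2]
      exact Subgroup.subgroupOf_self N
    have hcop := IsPGroup.pow_mem_and_commutator_mem_of_isCoatom (Q := Q) hQ
      (f.comp (Subgroup.inclusion hNH)) hco fun x hx => hf (a := Subgroup.inclusion hNH x) hx
    exact ⟨fun x hx => hcop.1 ⟨x, hx⟩, fun x hx y hy => hcop.2 ⟨x, hx⟩ ⟨y, hy⟩⟩
  have hpow (x : G) (hx : x ∈ N) : x ^ p = 1 := by
    rw [← Subgroup.mem_bot, ← hbot, mem_openFrattini]
    exact ⟨N.pow_mem hx p, fun M hMo hM => (key M hMo hM).1 x hx⟩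
  have hcomm (x : G) (hx : x ∈ N) (y : G) (hy : y ∈ N) : x * y = y * x := by
    have : x * y * x⁻¹ * y⁻¹ = 1 := by
      rw [← Subgroup.mem_bot, ← hbot, mem_openFrattini]
      exact ⟨N.mul_mem (N.mul_mem (N.mul_mem hx hy) (N.inv_mem hx)) (N.inv_mem hy),
        fun M hMo hM => (key M hMo hM).2 x hx y hy⟩
    rwa [mul_inv_eq_one, mul_inv_eq_iff_eq_mul] at this
  have hne : N ≠ ⊥ := by
    rintro rfl
    exact Subgroup.FiniteIndex.index_ne_zero (H := (⊥ : Subgroup G))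
      (by rw [Subgroup.index_bot, Nat.card_eq_zero_of_infinite])
  obtain ⟨x, hxN, hx1⟩ := N.bot_or_exists_ne_one.resolve_left hne
  have hfin : Finite (Subgroup.normalClosure {x}) :=
    Subgroup.finite_normalClosure_singleton hcomm hxN hp.ne_zero hpow
  have hidx := hji (Subgroup.normalClosure {x}) inferInstance
    (Set.Finite.isClosed (Set.finite_coe_iff.1 hfin)) fun h =>
      hx1 (Subgroup.mem_bot.1 (h ▸ Subgroup.subset_normalClosure rfl))
  have := (Subgroup.finite_iff_finite_and_finiteIndex _).2 ⟨hfin, hidx⟩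
  exact not_finite G

/-- The Frattini subgroup of an open normal subgroup lies in the Frattini subgroup of the whole
group: every maximal open subgroup of the whole group contains it. -/
theorem openFrattini_le_of_isCoatom [CompactSpace G] {N : Subgroup G} [N.Normal]
    (hN : IsOpen (N : Set G)) {M : Subgroup G} (hMo : IsOpen (M : Set G)) (hM : IsCoatom M) :
    openFrattini N ≤ M := by
  by_contra hle
  have hDN : openFrattini N ≤ N := inf_le_left
  have htop : M ⊔ openFrattini N = ⊤ := hM.2 _ (left_lt_sup.2 hle)
  have hLo : IsOpen ((M ⊓ N : Subgroup G) : Set G) := hMo.inter hN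
  have hlt : M ⊓ N < N := inf_le_right.lt_of_ne fun h => hle (hDN.trans (inf_eq_right.1 h))
  have : Finite (G ⧸ (M ⊓ N)) := Subgroup.quotient_finite_of_isOpen _ hLo
  have : (M ⊓ N).FiniteIndex := Subgroup.finiteIndex_of_finite_quotient
  obtain ⟨K, hLK, hK⟩ := Subgroup.exists_le_covBy_of_finiteIndex hlt
  have hDK : openFrattini N ≤ K := fun x hx =>
    (mem_openFrattini.1 hx).2 K (Subgroup.isOpen_mono hLK hLo) hK
  refine hK.lt.not_ge fun x hx => ?_
  -- Dedekind's modular law: `N = (M ⊓ N) ⊔ openFrattini N ≤ K`.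
  obtain ⟨m, hm, d, hd, rfl⟩ := Subgroup.mem_sup_of_normal_right.1 (htop ▸ Subgroup.mem_top x)
  refine K.mul_mem (hLK ⟨hm, ?_⟩) (hDK hd)
  simpa using N.mul_mem hx (N.inv_mem (hDN hd))

end

/-- A just infinite virtually pro-`p` group has finitely many maximal open subgroups, as they all
contain the intersection of the maximal open subgroups of a pro-`p` open normal subgroup. -/
theorem IsVirtuallyProP.finite_isCoatom_openSubgroup {G : Type u} [Group G] [TopologicalSpace G]
    [IsTopologicalGroup G] [CompactSpace G] [TotallyDisconnectedSpace G] (hG : IsJustInfinite G)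
    {p : ℕ} (hp : p.Prime) (h : IsVirtuallyProP p G) :
    {M : OpenSubgroup G | IsCoatom M}.Finite := by
  obtain ⟨H, hHc, hHf, hpro⟩ := h
  have hHo : IsOpen (H : Set G) := H.isOpen_of_isClosed_of_finiteIndex hHc
  have hNc : IsClosed (H.normalCore : Set G) := H.normalCore_isClosed hHc
  have hNo : IsOpen (H.normalCore : Set G) := Subgroup.isOpen_of_isClosed_of_finiteIndex _ hNc
  have : (openFrattini H.normalCore).FiniteIndex :=
    hG.2.2 _ inferInstance (isClosed_openFrattini hNc)
      (openFrattini_ne_bot_of_isJustInfinite hG hp hHo hpro H.normalCore_le)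
  refine ((openFrattini H.normalCore).finite_setOf_le_of_finiteIndex.preimage
    OpenSubgroup.toSubgroup_injective.injOn).subset fun M hM => ?_
  exact openFrattini_le_of_isCoatom hNo M.isOpen (OpenSubgroup.isCoatom_toSubgroup hM)

/-! ### The Frattini subgroup of a profinite group -/

/-- A quotient of a group by a subgroup containing the kernel of a homomorphism to a nilpotent group
is nilpotent. -/
theorem Group.IsNilpotent.quotient_of_ker_le {H Q : Type*} [Group H] [Group Q]
    [Group.IsNilpotent Q] (f : H →* Q) (V : Subgroup H) [V.Normal] (h : f.ker ≤ V) :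
    Group.IsNilpotent (H ⧸ V) := by
  have : Group.IsNilpotent (H ⧸ f.ker) :=
    Group.nilpotent_of_mulEquiv (QuotientGroup.quotientKerEquivRange f).symm
  exact Group.nilpotent_of_surjective (QuotientGroup.map f.ker V (MonoidHom.id H) h) fun x => by
    obtain ⟨x, rfl⟩ := QuotientGroup.mk_surjective x
    exact ⟨x, rfl⟩

/-- If there are finitely many maximal open subgroups, their intersection is an open pronilpotent
subgroup: its image in every finite quotient by an open normal subgroup lies in the Frattini
subgroup of that quotient, which is nilpotent. -/
theorem isVirtuallyPronilpotent_of_finite_isCoatom_openSubgroup {G : Type u} [Group G]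
    [TopologicalSpace G] [IsTopologicalGroup G] [CompactSpace G] [TotallyDisconnectedSpace G]
    (h : {M : OpenSubgroup G | IsCoatom M}.Finite) : IsVirtuallyPronilpotent G := by
  let Φ : Subgroup G := ⨅ M ∈ {M : OpenSubgroup G | IsCoatom M}, M.toSubgroup
  have hΦo : IsOpen (Φ : Set G) := by
    simp only [Φ, Subgroup.coe_iInf]
    exact h.isOpen_biInter fun M _ => M.isOpen
  have hΦc : IsClosed (Φ : Set G) := Φ.isClosed_of_isOpen hΦo
  have : Finite (G ⧸ Φ) := Φ.quotient_finite_of_isOpen hΦo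
  have : CompactSpace Φ := isCompact_iff_compactSpace.1 hΦc.isCompact
  refine ⟨Φ, hΦc, Subgroup.finiteIndex_of_finite_quotient,
    isInverseLimitOfFinite_of_quotients fun V => ?_⟩
  obtain ⟨U, hU⟩ := exists_openNormalSubgroup_subgroupOf_le hΦo V.isOpen'
  have : Finite (G ⧸ U.toSubgroup) := U.toSubgroup.quotient_finite_of_isOpen U.isOpen'
  have hs := QuotientGroup.mk'_surjective U.toSubgroup
  have hmem (x : Φ) : QuotientGroup.mk' U.toSubgroup x ∈ frattini (G ⧸ U.toSubgroup) := by
    simp only [frattini, Order.radical, Subgroup.mem_iInf]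
    intro B hB
    have hco := Subgroup.isCoatom_comap_of_surjective hs hB
    have hUB : U.toSubgroup ≤ B.comap (QuotientGroup.mk' U.toSubgroup) := by
      have := MonoidHom.ker_le_comap (QuotientGroup.mk' U.toSubgroup) B
      rwa [QuotientGroup.ker_mk'] at this
    let M : OpenSubgroup G :=
      ⟨B.comap (QuotientGroup.mk' U.toSubgroup), Subgroup.isOpen_mono hUB U.isOpen'⟩
    have hM : IsCoatom M := by
      refine ⟨fun h => hco.1 (congrArg OpenSubgroup.toSubgroup h), fun K hK => ?_⟩
      exact OpenSubgroup.toSubgroup_injective (hco.2 K.toSubgroup hK)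
    have hx : (x : G) ∈ ⨅ M ∈ {M : OpenSubgroup G | IsCoatom M}, M.toSubgroup := x.2
    simp only [Subgroup.mem_iInf] at hx
    exact hx M hM
  have := frattini_nilpotent (G := G ⧸ U.toSubgroup)
  let f : Φ →* frattini (G ⧸ U.toSubgroup) :=
    ((QuotientGroup.mk' U.toSubgroup).comp Φ.subtype).codRestrict _ hmem
  refine Group.IsNilpotent.quotient_of_ker_le f V.toSubgroup fun x hx => hU ?_
  exact (QuotientGroup.eq_one_iff (x : G)).1 (congrArg Subtype.val hx)

theorem mainTheorem4 (G : Type u) [Group G] [TopologicalSpace G] [IsTopologicalGroup G]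
    [CompactSpace G] [TotallyDisconnectedSpace G] (hG : IsJustInfinite G) :
    List.TFAE [
      IsVirtuallyPronilpotent G,
      ∃ p : ℕ, p.Prime ∧ IsVirtuallyProP p G,
      {M : OpenSubgroup G | IsCoatom M}.Finite] := by
  tfae_have 1 → 2 := IsVirtuallyPronilpotent.exists_isVirtuallyProP hG
  tfae_have 2 → 3 := fun ⟨_, hp, h⟩ => h.finite_isCoatom_openSubgroup hG hp
  tfae_have 3 → 1 := isVirtuallyPronilpotent_of_finite_isCoatom_openSubgroup
  tfae_finish
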